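/- Let $\mathcal H$ be a complex Hilbert space of finite dimension at least $2$, let $|\Psi\rangle\in\mathcal H$ be a unit vector (the target state, for example a qudit graph state), let $0<\lambda<1$ and $\nu:=1-\lambda$, and put $$\Omega:=|\Psi\rangle\langle\Psi|+\lambda\,(\mathbb 1-|\Psi\rangle\langle\Psi|),\qquad \overline\Omega:=\mathbb 1-\Omega .$$ For integers $N\ge 1$, $0\le k\le N-1$, and a permutation-invariant density operator $\rho$ on $\mathcal H^{\otimes(N+1)}$ let $$p_k(\rho):=\sum_{i=0}^k\binom Ni\operatorname{tr}\bigl([\Omega^{\otimes(N-i)}\otimes\overline\Omega^{\otimes i}\otimes\mathbb 1]\rho\bigr),\qquad f_k(\rho):=\sum_{i=0}^k\binom Ni\operatorname{tr}\bigl([\Omega^{\otimes(N-i)}\otimes\overline\Omega^{\otimes i}\otimes|\Psi\rangle\langle\Psi|]\rho\bigr)$$ and, when $p_k(\rho)>0$, $F_k(\rho):=f_k(\rho)/p_k(\rho)$. Here permutation-invariant means invariant under conjugation with every permutation of the $N+1$ tensor factors. If each of the first $N$ systems is subjected to the two-outcome test $\{\Omega,\overline\Omega\}$, then $p_k(\rho)$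 is the probability that at most $k$ tests fail, and $F_k(\rho)$ is the fidelity of the remaining system with $|\Psi\rangle$ conditioned on this event. For $0<\delta\le 1$ the guaranteed infidelity is $$\bar\epsilon_\lambda(k,N,\delta):=1-\min_\rho\{F_k(\rho)\mid p_k(\rho)\ge\delta\},$$ where the minimum is over all permutation-invariant density operators $\rho$ on $\mathcal H^{\otimes(N+1)}$. Theorem. Suppose $0<s,\lambda<1$ and $0<\delta\le 1/4$. Then for every integer $N\ge 1$ $$s-\frac1{\nu N}<\bar\epsilon_\lambda(\lfloor\nu sN\rfloor,N,\delta)\le s+\frac1{\nu\lambda}\sqrt{\frac{s\ln\delta^{-1}}N}+\frac{\ln\delta^{-1}}{2\nu^2\lambda N}+\frac2{\lambda N}.$$ Consequently $\bar\epsilon_\lambda(\lfloor\nu sN\rfloor,N,\delta)\to s$ as $N\to\infty$. -/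

import Mathlib

open Matrix
open scoped ComplexOrder

/-! ## Multipartite operators and states

A finite dimensional Hilbert space with a fixed orthonormal basis indexed by `ι` is
`EuclideanSpace ℂ ι`, and its operators are `Matrix ι ι ℂ`. The `m`-fold tensor power has the
product basis, which is indexed by `Fin m → ι`. -/

section Defs

set_option linter.unusedSectionVars false

variable {ι : Type*} [Fintype ι] [DecidableEq ι] {m : ℕ}

/-- The operator `A₁ ⊗ ⋯ ⊗ Aₘ` on the `m`-fold tensor power. -/
def tensorOp (A : Fin m → Matrix ι ι ℂ) : Matrix (Fin m → ι) (Fin m → ι) ℂ :=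
  Matrix.of fun x y => ∏ j, A j (x j) (y j)

/-- The operator `|Ψ⟩⟨Ψ|`. -/
def rankOneProj (Ψ : EuclideanSpace ℂ ι) : Matrix ι ι ℂ :=
  Matrix.of fun x y => Ψ x * star (Ψ y)

/-- The homogeneous strategy `Ω = |Ψ⟩⟨Ψ| + lam (1 - |Ψ⟩⟨Ψ|)` for the target state `Ψ`. -/
noncomputable def strategy (lam : ℝ) (Ψ : EuclideanSpace ℂ ι) : Matrix ι ι ℂ :=
  rankOneProj Ψ + (lam : ℂ) • (1 - rankOneProj Ψ)

/-- Density operators (states). -/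
def IsState {κ : Type*} [Fintype κ] (ρ : Matrix κ κ ℂ) : Prop :=
  ρ.PosSemidef ∧ ρ.trace = 1

/-- Invariance of an operator on the `m`-fold tensor power under conjugation with every
permutation of the `m` tensor factors. -/
def IsPermInvariant (ρ : Matrix (Fin m → ι) (Fin m → ι) ℂ) : Prop :=
  ∀ π : Equiv.Perm (Fin m), ∀ x y : Fin m → ι, ρ (x ∘ π) (y ∘ π) = ρ x y

/-- The operator `Ω^{⊗(N-i)} ⊗ (1-Ω)^{⊗i} ⊗ A` on `N + 1` systems (for `i ≤ N`). -/
def testOp (Ω A : Matrix ι ι ℂ) (N i : ℕ) :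
    Matrix (Fin (N + 1) → ι) (Fin (N + 1) → ι) ℂ :=
  tensorOp fun j => if (j : ℕ) < N - i then Ω else if (j : ℕ) < N then 1 - Ω else A

/-- `∑_{i ≤ k} (N choose i) tr([Ω^{⊗(N-i)} ⊗ (1-Ω)^{⊗i} ⊗ A] ρ)`. -/
noncomputable def testWeight (Ω A : Matrix ι ι ℂ) (k N : ℕ)
    (ρ : Matrix (Fin (N + 1) → ι) (Fin (N + 1) → ι) ℂ) : ℝ :=
  ∑ i ∈ Finset.range (k + 1), (N.choose i : ℝ) * ((testOp Ω A N i * ρ).trace).re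

/-- The probability `p_k(ρ)` that at most `k` failures occur in the `N` tests. -/
noncomputable def acceptProb (lam : ℝ) (Ψ : EuclideanSpace ℂ ι) (k N : ℕ)
    (ρ : Matrix (Fin (N + 1) → ι) (Fin (N + 1) → ι) ℂ) : ℝ :=
  testWeight (strategy lam Ψ) 1 k N ρ

/-- The fidelity `F_k(ρ) = f_k(ρ) / p_k(ρ)` between the target state and the reduced state on the
remaining system, conditioned on acceptance. -/
noncomputable def condFidelity (lam : ℝ) (Ψ : EuclideanSpace ℂ ι) (k N : ℕ)
    (ρ : Matrix (Fin (N + 1) → ι) (Fin (N + 1) → ι) ℂ) : ℝ :=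
  testWeight (strategy lam Ψ) (rankOneProj Ψ) k N ρ / acceptProb lam Ψ k N ρ

/-- The fidelities `F_k(ρ)` of the permutation invariant states `ρ` with `p_k(ρ) ≥ δ`. -/
def fidelitySet (lam : ℝ) (Ψ : EuclideanSpace ℂ ι) (k N : ℕ) (δ : ℝ) : Set ℝ :=
  {F | ∃ ρ : Matrix (Fin (N + 1) → ι) (Fin (N + 1) → ι) ℂ,
    IsState ρ ∧ IsPermInvariant ρ ∧ δ ≤ acceptProb lam Ψ k N ρ ∧ F = condFidelity lam Ψ k N ρ}

/-- The guaranteed infidelity. The infimum is a minimum, see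
`isLeast_one_sub_guaranteedInfidelity`. -/
noncomputable def guaranteedInfidelity (lam : ℝ) (Ψ : EuclideanSpace ℂ ι) (k N : ℕ) (δ : ℝ) : ℝ :=
  1 - sInf (fidelitySet lam Ψ k N δ)

/-! ## The minimum in the guaranteed infidelity exists -/

theorem tensorOp_mul_tensorOp (A B : Fin m → Matrix ι ι ℂ) :
    tensorOp A * tensorOp B = tensorOp fun j => A j * B j := by
  ext x y
  simp only [tensorOp, Matrix.mul_apply, Matrix.of_apply, ← Finset.prod_mul_distrib]
  rw [Finset.prod_univ_sum, Fintype.piFinset_univ]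

theorem trace_tensorOp (A : Fin m → Matrix ι ι ℂ) :
    (tensorOp A).trace = ∏ j, (A j).trace := by
  simp only [tensorOp, Matrix.trace, Matrix.diag_apply, Matrix.of_apply]
  rw [Finset.prod_univ_sum, Fintype.piFinset_univ]

theorem sum_mul_star_of_norm_eq_one {Ψ : EuclideanSpace ℂ ι} (hΨ : ‖Ψ‖ = 1) :
    ∑ x, Ψ x * star (Ψ x) = 1 := by
  have h : ∑ x, ‖Ψ x‖ ^ 2 = 1 := by
    rw [← EuclideanSpace.norm_sq_eq, hΨ]; norm_num
  have h2 : ∀ x, Ψ x * star (Ψ x) = ((‖Ψ x‖ ^ 2 : ℝ) : ℂ) := by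
    intro x
    rw [← starRingEnd_apply, Complex.mul_conj']
    push_cast; rfl
  simp only [h2]
  rw [← Complex.ofReal_sum, h]; norm_num

theorem trace_rankOneProj {Ψ : EuclideanSpace ℂ ι} (hΨ : ‖Ψ‖ = 1) :
    (rankOneProj Ψ).trace = 1 := sum_mul_star_of_norm_eq_one hΨ

theorem rankOneProj_mul_self {Ψ : EuclideanSpace ℂ ι} (hΨ : ‖Ψ‖ = 1) :
    rankOneProj Ψ * rankOneProj Ψ = rankOneProj Ψ := by
  ext x y
  simp only [rankOneProj, Matrix.mul_apply, Matrix.of_apply]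
  have h := sum_mul_star_of_norm_eq_one hΨ
  calc ∑ j, Ψ x * star (Ψ j) * (Ψ j * star (Ψ y))
      = Ψ x * star (Ψ y) * ∑ j, Ψ j * star (Ψ j) := by
        rw [Finset.mul_sum]; exact Finset.sum_congr rfl fun j _ => by ring
    _ = _ := by rw [h, mul_one]

theorem strategy_mul_rankOneProj (lam : ℝ) {Ψ : EuclideanSpace ℂ ι} (hΨ : ‖Ψ‖ = 1) :
    strategy lam Ψ * rankOneProj Ψ = rankOneProj Ψ := by
  simp [strategy, add_mul, sub_mul, rankOneProj_mul_self hΨ]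

theorem isState_tensorPower {Ψ : EuclideanSpace ℂ ι} (hΨ : ‖Ψ‖ = 1) (m : ℕ) :
    IsState (tensorOp fun _ : Fin m => rankOneProj Ψ) := by
  constructor
  · have : (tensorOp fun _ : Fin m => rankOneProj Ψ)
        = Matrix.vecMulVec (fun x => ∏ j, Ψ (x j)) (star fun x => ∏ j, Ψ (x j)) := by
      ext x y
      simp [tensorOp, rankOneProj, Matrix.vecMulVec, Finset.prod_mul_distrib]
    rw [this]
    exact Matrix.posSemidef_vecMulVec_self_star _
  · rw [trace_tensorOp]; simp [trace_rankOneProj hΨ]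

theorem acceptProb_tensorPower (lam : ℝ) {Ψ : EuclideanSpace ℂ ι} (hΨ : ‖Ψ‖ = 1) (k N : ℕ) :
    acceptProb lam Ψ k N (tensorOp fun _ => rankOneProj Ψ) = 1 := by
  unfold acceptProb testWeight testOp
  rw [Finset.sum_eq_single 0]
  · rw [tensorOp_mul_tensorOp, trace_tensorOp, Finset.prod_eq_one]
    · simp
    · intro j _
      split_ifs <;> first
        | rw [strategy_mul_rankOneProj lam hΨ, trace_rankOneProj hΨ]
        | rw [one_mul, trace_rankOneProj hΨ]
        | omega
  · intro i _ hi
    rcases lt_or_ge N i with h | h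
    · simp [Nat.choose_eq_zero_of_lt h]
    · rw [tensorOp_mul_tensorOp, trace_tensorOp,
        Finset.prod_eq_zero (Finset.mem_univ (⟨N - i, by omega⟩ : Fin (N + 1)))]
      · simp
      · have h1 : N - i < N := by omega
        simp [h1, sub_mul, strategy_mul_rankOneProj lam hΨ]
  · simp

open scoped MatrixOrder Matrix.Norms.L2Operator in
theorem exists_eq_conjTranspose_mul {κ : Type*} [Fintype κ] [DecidableEq κ] {ρ : Matrix κ κ ℂ}
    (h : ρ.PosSemidef) : ∃ B : Matrix κ κ ℂ, ρ = Bᴴ * B :=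
  CStarAlgebra.nonneg_iff_eq_star_mul_self.mp h.nonneg

theorem isCompact_states (κ : Type*) [Fintype κ] [DecidableEq κ] :
    IsCompact {ρ : Matrix κ κ ℂ | IsState ρ} := by
  have htr : ∀ B : Matrix κ κ ℂ, (Bᴴ * B).trace = ((∑ y, ∑ x, ‖B x y‖ ^ 2 : ℝ) : ℂ) := by
    intro B
    simp only [Matrix.trace, Matrix.diag_apply, Matrix.mul_apply, Matrix.conjTranspose_apply]
    push_cast
    refine Finset.sum_congr rfl fun y _ => Finset.sum_congr rfl fun x _ => ?_
    rw [← starRingEnd_apply, Complex.conj_mul']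
  have hK : IsCompact {B : Matrix κ κ ℂ | (Bᴴ * B).trace = 1} := by
    have hc : IsCompact (Set.univ.pi fun _ : κ => Set.univ.pi fun _ : κ =>
        Metric.closedBall (0 : ℂ) 1) :=
      isCompact_univ_pi fun _ => isCompact_univ_pi fun _ => isCompact_closedBall _ _
    refine hc.of_isClosed_subset (isClosed_eq (by fun_prop) continuous_const) ?_
    intro B hB x _ y _
    have h1 : (∑ y, ∑ x, ‖B x y‖ ^ 2 : ℝ) = 1 := by
      have := (htr B).symm.trans hB
      exact_mod_cast this
    have h2 : ‖B x y‖ ^ 2 ≤ ∑ y, ∑ x, ‖B x y‖ ^ 2 :=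
      (Finset.single_le_sum (f := fun x => ‖B x y‖ ^ 2) (fun _ _ => by positivity)
        (Finset.mem_univ x)).trans
      (Finset.single_le_sum (f := fun y => ∑ x, ‖B x y‖ ^ 2) (fun _ _ => by positivity)
        (Finset.mem_univ y))
    rw [h1] at h2
    rw [mem_closedBall_zero_iff]
    nlinarith [norm_nonneg (B x y)]
  have himg : {ρ : Matrix κ κ ℂ | IsState ρ}
      = (fun B : Matrix κ κ ℂ => Bᴴ * B) '' {B | (Bᴴ * B).trace = 1} := by
    ext ρ
    constructor
    · rintro ⟨h1, h2⟩
      obtain ⟨B, rfl⟩ := exists_eq_conjTranspose_mul h1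
      exact ⟨B, h2, rfl⟩
    · rintro ⟨B, hB, rfl⟩
      exact ⟨Matrix.posSemidef_conjTranspose_mul_self B, hB⟩
  rw [himg]
  exact hK.image (by fun_prop)

theorem continuous_testWeight (Ω A : Matrix ι ι ℂ) (k N : ℕ) :
    Continuous (testWeight Ω A k N) := by
  unfold testWeight
  fun_prop

/-- The minimal fidelity is attained. -/
theorem isLeast_one_sub_guaranteedInfidelity (lam : ℝ) {Ψ : EuclideanSpace ℂ ι} (hΨ : ‖Ψ‖ = 1)
    (k N : ℕ) {δ : ℝ} (h0 : 0 < δ) (h1 : δ ≤ 1) :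
    IsLeast (fidelitySet lam Ψ k N δ) (1 - guaranteedInfidelity lam Ψ k N δ) := by
  set S : Set (Matrix (Fin (N + 1) → ι) (Fin (N + 1) → ι) ℂ) :=
    {ρ | IsState ρ} ∩ ({ρ | IsPermInvariant ρ} ∩ {ρ | δ ≤ acceptProb lam Ψ k N ρ}) with hS
  have hp : Continuous (acceptProb lam Ψ k N) := continuous_testWeight _ _ _ _
  have hcl : IsClosed {ρ : Matrix (Fin (N + 1) → ι) (Fin (N + 1) → ι) ℂ | IsPermInvariant ρ} := by
    simp only [IsPermInvariant, Set.ofPred_forall]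
    exact isClosed_iInter fun π => isClosed_iInter fun x => isClosed_iInter fun y =>
      isClosed_eq (by fun_prop) (by fun_prop)
  have hSc : IsCompact S :=
    (isCompact_states _).inter_right (hcl.inter (isClosed_le continuous_const hp))
  have himg : fidelitySet lam Ψ k N δ = condFidelity lam Ψ k N '' S := by
    ext F
    constructor
    · rintro ⟨ρ, a, b, c, d⟩; exact ⟨ρ, ⟨a, b, c⟩, d.symm⟩
    · rintro ⟨ρ, ⟨a, b, c⟩, d⟩; exact ⟨ρ, a, b, c, d.symm⟩
  have hF : ContinuousOn (condFidelity lam Ψ k N) S :=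
    (continuous_testWeight _ _ _ _).continuousOn.div hp.continuousOn
      fun ρ hρ => (h0.trans_le hρ.2.2).ne'
  have hne : S.Nonempty := by
    refine ⟨tensorOp fun _ => rankOneProj Ψ, isState_tensorPower hΨ _, ?_, ?_⟩
    · intro π x y
      exact Equiv.prod_comp π fun j => rankOneProj Ψ (x j) (y j)
    · rw [Set.mem_ofPred_eq, acceptProb_tensorPower lam hΨ]; exact h1
  have hc := hSc.image_of_continuousOn hF
  rw [guaranteedInfidelity, sub_sub_cancel, himg]
  exact hc.isLeast_sInf (hne.image _)

end Defs

/-! ### Reduction to an exchangeable classical outcome distribution. -/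

section OutcomeDistribution

set_option linter.unusedSectionVars false

variable {ι : Type*} [Fintype ι] [DecidableEq ι] {m : ℕ}

/-! Write `P = |Ψ⟩⟨Ψ|` and `ν = 1 - λ`. Refine the test to three effects: `P`, `λ(1 - P)` (false
pass) and `ν(1 - P)` (failure). Measuring all `N + 1` systems of a permutation-invariant state gives
an exchangeable distribution on `{0,1,2}^(N+1)`, in which `p_k` is the probability of at most `k`
failures among the first `N` systems, and `λ(p_k - f_k)` is the probability that moreover the last
system is a false pass.

Upper bound: by exchangeability, `(N + 1) λ (p_k - f_k)` is the expected number `F` of false passes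
on the event that the total number `Z` of failures is at most `k`. If `λ e^α + ν e^(-θ) = 1`, the
three effects weighted by `1, e^α, e^(-θ)` sum to the identity, so `E exp(αF - θZ) = 1` for every
state. A tangent-line bound on the exponential turns this into `mul_one_sub_condFidelity_le`;
Hoeffding's lemma supplies explicit `α` and `θ` in terms of one parameter, which
`guaranteedInfidelity_le` optimises.

Lower bound: take `N + 1` copies of a state of infidelity `k/(νN)`. The number of failures is then
binomial with mean exactly `k`. An integer mean is a median (`half_le_binomialCDF`), so acceptance
has probability at least `1/2 ≥ δ`, while the product structure leaves the infidelity of the last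
system unchanged. -/

theorem tensorOp_sum_smul {κ : Type*} [Fintype κ] [DecidableEq κ] (g : Fin m → κ → ℂ)
    (E : κ → Matrix ι ι ℂ) :
    tensorOp (fun j => ∑ a, g j a • E a)
      = ∑ o : Fin m → κ, (∏ j, g j (o j)) • tensorOp fun j => E (o j) := by
  ext x y
  simp only [tensorOp, Matrix.sum_apply, Matrix.smul_apply, Matrix.of_apply, smul_eq_mul]
  rw [Finset.prod_univ_sum, Fintype.piFinset_univ]
  exact Finset.sum_congr rfl fun o _ => Finset.prod_mul_distrib

theorem conjTranspose_tensorOp (A : Fin m → Matrix ι ι ℂ) :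
    (tensorOp A)ᴴ = tensorOp fun j => (A j)ᴴ := by
  ext x y
  simp [tensorOp, Matrix.conjTranspose_apply]

theorem conjTranspose_rankOneProj (Ψ : EuclideanSpace ℂ ι) :
    (rankOneProj Ψ)ᴴ = rankOneProj Ψ := by
  ext x y
  simp [rankOneProj, mul_comm]

theorem one_sub_rankOneProj_mul_self {Ψ : EuclideanSpace ℂ ι} (hΨ : ‖Ψ‖ = 1) :
    (1 - rankOneProj Ψ) * (1 - rankOneProj Ψ) = 1 - rankOneProj Ψ := by
  simp [mul_sub, sub_mul, rankOneProj_mul_self hΨ]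

theorem trace_tensorOp_comp_mul {ρ : Matrix (Fin m → ι) (Fin m → ι) ℂ} (hρ : IsPermInvariant ρ)
    (A : Fin m → Matrix ι ι ℂ) (π : Equiv.Perm (Fin m)) :
    ((tensorOp fun j => A (π j)) * ρ).trace = (tensorOp A * ρ).trace := by
  simp only [Matrix.trace, Matrix.diag_apply, Matrix.mul_apply, tensorOp, Matrix.of_apply]
  let e : (Fin m → ι) ≃ (Fin m → ι) := Equiv.arrowCongr π.symm (Equiv.refl ι)
  have he : ∀ x, e x = x ∘ π := fun x => by ext; simp [e]
  rw [← Equiv.sum_comp e]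
  refine Finset.sum_congr rfl fun x _ => ?_
  rw [← Equiv.sum_comp e]
  refine Finset.sum_congr rfl fun y _ => ?_
  simp only [he, hρ π]
  congr 1
  exact Equiv.prod_comp π fun j => A j (x j) (y j)

/-- The effects of the refined test: the system is in the target state, it is orthogonal to the
target state but passes the test, it fails the test. -/
noncomputable def refinedEffect (lam : ℝ) (Ψ : EuclideanSpace ℂ ι) : Fin 3 → Matrix ι ι ℂ :=
  ![rankOneProj Ψ, (lam : ℂ) • (1 - rankOneProj Ψ), ((1 - lam : ℝ) : ℂ) • (1 - rankOneProj Ψ)]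

/-- The joint outcome distribution when all systems are subjected to the refined test. -/
noncomputable def outcomeProb (lam : ℝ) (Ψ : EuclideanSpace ℂ ι)
    (ρ : Matrix (Fin m → ι) (Fin m → ι) ℂ) (o : Fin m → Fin 3) : ℝ :=
  ((tensorOp fun j => refinedEffect lam Ψ (o j)) * ρ).trace.re

theorem exists_refinedEffect_eq_conjTranspose_mul {lam : ℝ} (h0 : 0 ≤ lam) (h1 : lam ≤ 1)
    {Ψ : EuclideanSpace ℂ ι} (hΨ : ‖Ψ‖ = 1) (a : Fin 3) :
    ∃ K : Matrix ι ι ℂ, refinedEffect lam Ψ a = Kᴴ * K := by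
  have key : ∀ c : ℝ, 0 ≤ c → ∃ K : Matrix ι ι ℂ, (c : ℂ) • (1 - rankOneProj Ψ) = Kᴴ * K := by
    intro c hc
    refine ⟨((√c : ℝ) : ℂ) • (1 - rankOneProj Ψ), ?_⟩
    rw [Matrix.conjTranspose_smul, Matrix.conjTranspose_sub, conjTranspose_rankOneProj,
      Matrix.conjTranspose_one, smul_mul_smul_comm, one_sub_rankOneProj_mul_self hΨ]
    congr 1
    rw [← starRingEnd_apply, Complex.conj_ofReal, ← Complex.ofReal_mul, Real.mul_self_sqrt hc]
  fin_cases a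
  · exact ⟨rankOneProj Ψ, by
      rw [conjTranspose_rankOneProj, rankOneProj_mul_self hΨ]; rfl⟩
  · exact key lam h0
  · exact key (1 - lam) (by linarith)

theorem outcomeProb_nonneg {lam : ℝ} (h0 : 0 ≤ lam) (h1 : lam ≤ 1) {Ψ : EuclideanSpace ℂ ι}
    (hΨ : ‖Ψ‖ = 1) {ρ : Matrix (Fin m → ι) (Fin m → ι) ℂ} (hρ : ρ.PosSemidef)
    (o : Fin m → Fin 3) : 0 ≤ outcomeProb lam Ψ ρ o := by
  choose K hK using fun j => exists_refinedEffect_eq_conjTranspose_mul h0 h1 hΨ (o j)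
  rw [outcomeProb]
  simp only [hK]
  -- With the effect written as `Kᴴ K`, cyclicity turns the trace into that of the positive operator
  -- `K ρ Kᴴ`.
  rw [← tensorOp_mul_tensorOp, ← conjTranspose_tensorOp, Matrix.mul_assoc, Matrix.trace_mul_comm]
  exact (Complex.nonneg_iff.mp (hρ.mul_mul_conjTranspose_same _).trace_nonneg).1

theorem outcomeProb_comp (lam : ℝ) (Ψ : EuclideanSpace ℂ ι)
    {ρ : Matrix (Fin m → ι) (Fin m → ι) ℂ} (hρ : IsPermInvariant ρ) (o : Fin m → Fin 3)
    (π : Equiv.Perm (Fin m)) : outcomeProb lam Ψ ρ (o ∘ π) = outcomeProb lam Ψ ρ o := by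
  rw [outcomeProb, outcomeProb,
    ← trace_tensorOp_comp_mul hρ (fun j => refinedEffect lam Ψ (o j)) π]
  rfl

theorem sum_outcomeProb_comp (lam : ℝ) (Ψ : EuclideanSpace ℂ ι)
    {ρ : Matrix (Fin m → ι) (Fin m → ι) ℂ} (hρ : IsPermInvariant ρ) (π : Equiv.Perm (Fin m))
    (φ : (Fin m → Fin 3) → ℝ) :
    ∑ o, φ (o ∘ π) * outcomeProb lam Ψ ρ o = ∑ o, φ o * outcomeProb lam Ψ ρ o := by
  let e : (Fin m → Fin 3) ≃ (Fin m → Fin 3) := Equiv.arrowCongr π.symm (Equiv.refl _)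
  have he : ∀ x, e x = x ∘ π := fun x => by ext; simp [e]
  rw [← Equiv.sum_comp e fun o => φ o * outcomeProb lam Ψ ρ o]
  simp only [he, outcomeProb_comp lam Ψ hρ]

theorem re_trace_tensorOp_sum_smul_mul (lam : ℝ) (Ψ : EuclideanSpace ℂ ι)
    (ρ : Matrix (Fin m → ι) (Fin m → ι) ℂ) (g : Fin m → Fin 3 → ℝ) :
    ((tensorOp fun j => ∑ a, (g j a : ℂ) • refinedEffect lam Ψ a) * ρ).trace.re
      = ∑ o, (∏ j, g j (o j)) * outcomeProb lam Ψ ρ o := by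
  rw [tensorOp_sum_smul, Finset.sum_mul, Matrix.trace_sum, Complex.re_sum]
  refine Finset.sum_congr rfl fun o _ => ?_
  rw [Matrix.smul_mul, Matrix.trace_smul, ← Complex.ofReal_prod, smul_eq_mul,
    Complex.re_ofReal_mul, outcomeProb]

/-- The set of failures among the first `N` tests. -/
def failureSet {N : ℕ} (o : Fin (N + 1) → Fin 3) : Finset (Fin N) :=
  Finset.univ.filter fun j => o j.castSucc = 2

/-- A bijection from `S` to `T` extends to a permutation of the first `N` systems; fixing the last
system, it preserves the outcome distribution and carries one event to the other. -/
theorem sum_failureSet_eq_of_card_eq (lam : ℝ) (Ψ : EuclideanSpace ℂ ι) {N : ℕ}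
    {ρ : Matrix (Fin (N + 1) → ι) (Fin (N + 1) → ι) ℂ} (hρ : IsPermInvariant ρ)
    (r : Fin 3 → ℝ) {S T : Finset (Fin N)} (hST : S.card = T.card) :
    ∑ o, (if failureSet o = S then r (o (Fin.last N)) else 0) * outcomeProb lam Ψ ρ o
      = ∑ o, (if failureSet o = T then r (o (Fin.last N)) else 0) * outcomeProb lam Ψ ρ o := by
  let τ : Equiv.Perm (Fin N) := (Finset.equivOfCardEq hST).extendSubtype
  have hτ : ∀ j, τ j ∈ T ↔ j ∈ S := by
    intro j
    constructor
    · intro h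
      by_contra hj
      exact Equiv.extendSubtype_not_mem (Finset.equivOfCardEq hST) j hj h
    · exact fun h => Equiv.extendSubtype_mem (Finset.equivOfCardEq hST) j h
  let π : Equiv.Perm (Fin (N + 1)) :=
    finSuccEquivLast.trans ((Equiv.optionCongr τ).trans finSuccEquivLast.symm)
  have h1 : ∀ j, π (Fin.castSucc j) = Fin.castSucc (τ j) := fun j => by simp [π]
  have h2 : π (Fin.last N) = Fin.last N := by simp [π]
  rw [← sum_outcomeProb_comp lam Ψ hρ π]
  refine Finset.sum_congr rfl fun o _ => ?_
  have : failureSet (o ∘ π) = S ↔ failureSet o = T := by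
    simp only [Finset.ext_iff, failureSet, Finset.mem_filter, Finset.mem_univ, true_and,
      Function.comp_apply, h1, ← hτ]
    exact Equiv.forall_congr_right τ (q := fun j => o j.castSucc = 2 ↔ j ∈ T)
  simp only [this, Function.comp_apply, h2]

/-- The binomial coefficient counts the possible failure sets of a given size, all of which have
equal weight. This removes the fixed order of passes and failures built into `testOp`. -/
theorem choose_mul_sum_failureSet (lam : ℝ) (Ψ : EuclideanSpace ℂ ι) {N : ℕ}
    {ρ : Matrix (Fin (N + 1) → ι) (Fin (N + 1) → ι) ℂ} (hρ : IsPermInvariant ρ)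
    (r : Fin 3 → ℝ) (S : Finset (Fin N)) :
    (N.choose S.card : ℝ) *
        ∑ o, (if failureSet o = S then r (o (Fin.last N)) else 0) * outcomeProb lam Ψ ρ o
      = ∑ o, (if (failureSet o).card = S.card then r (o (Fin.last N)) else 0)
          * outcomeProb lam Ψ ρ o := by
  have h : ∀ o : Fin (N + 1) → Fin 3,
      (if (failureSet o).card = S.card then r (o (Fin.last N)) else 0)
        = ∑ T ∈ Finset.univ.powersetCard S.card,
          if failureSet o = T then r (o (Fin.last N)) else 0 := by
    intro o
    rw [Finset.sum_ite_eq]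
    simp [Finset.mem_powersetCard]
  simp only [h, Finset.sum_mul]
  rw [Finset.sum_comm, Finset.sum_congr rfl fun T hT => sum_failureSet_eq_of_card_eq lam Ψ hρ r
    (Finset.mem_powersetCard.mp hT).2, Finset.sum_const, Finset.card_powersetCard,
    Finset.card_univ, Fintype.card_fin, nsmul_eq_mul]

theorem card_filter_sub_le {N i : ℕ} (h : i ≤ N) :
    (Finset.univ.filter fun j : Fin N => N - i ≤ (j : ℕ)).card = i := by
  have h1 := Finset.card_map (Fin.valEmbedding (n := N))
    (s := Finset.univ.filter fun j : Fin N => N - i ≤ (j : ℕ))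
  rw [← h1]
  have : (Finset.univ.filter fun j : Fin N => N - i ≤ (j : ℕ)).map Fin.valEmbedding
      = Finset.Ico (N - i) N := by
    ext x
    simp only [Finset.mem_map, Finset.mem_filter, Finset.mem_univ, true_and, Finset.mem_Ico,
      Fin.valEmbedding_apply]
    constructor
    · rintro ⟨j, hj, rfl⟩; exact ⟨hj, j.2⟩
    · rintro ⟨a, b⟩; exact ⟨⟨x, b⟩, a, rfl⟩
  rw [this, Nat.card_Ico]
  omega

theorem re_trace_testOp_mul (lam : ℝ) (Ψ : EuclideanSpace ℂ ι) {N i : ℕ}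
    (ρ : Matrix (Fin (N + 1) → ι) (Fin (N + 1) → ι) ℂ) (r : Fin 3 → ℝ) :
    (testOp (strategy lam Ψ) (∑ a, (r a : ℂ) • refinedEffect lam Ψ a) N i * ρ).trace.re
      = ∑ o, (if failureSet o = Finset.univ.filter (fun j : Fin N => N - i ≤ (j : ℕ))
          then r (o (Fin.last N)) else 0) * outcomeProb lam Ψ ρ o := by
  -- `Ω` is the sum of effects `0` and `1`, and `1 - Ω` is effect `2`; hence the 0/1 weights on the
  -- first `N` factors, with `r` on the last.
  let g : Fin (N + 1) → Fin 3 → ℝ := fun j a =>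
    if (j : ℕ) < N - i then (if a = 2 then 0 else 1)
    else if (j : ℕ) < N then (if a = 2 then 1 else 0) else r a
  have hg : testOp (strategy lam Ψ) (∑ a, (r a : ℂ) • refinedEffect lam Ψ a) N i
      = tensorOp fun j => ∑ a, (g j a : ℂ) • refinedEffect lam Ψ a := by
    unfold testOp
    congr 1
    ext1 j
    simp only [g]
    split_ifs
    · simp [Fin.sum_univ_three, refinedEffect, strategy]
    · simp [refinedEffect, strategy, sub_smul, sub_sub]
    · rfl
  rw [hg, re_trace_tensorOp_sum_smul_mul]
  refine Finset.sum_congr rfl fun o _ => ?_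
  congr 1
  rw [Fin.prod_univ_castSucc]
  have hlast : g (Fin.last N) (o (Fin.last N)) = r (o (Fin.last N)) := by
    simp [g]
  have hj : ∀ j : Fin N, g j.castSucc (o j.castSucc)
      = if (o j.castSucc = 2 ↔ N - i ≤ (j : ℕ)) then 1 else 0 := by
    intro j
    have := j.2
    simp only [g, Fin.val_castSucc, this, if_true]
    by_cases h1 : (j : ℕ) < N - i <;> by_cases h2 : o j.castSucc = 2 <;> simp [h1, h2] <;> omega
  rw [hlast, Finset.prod_congr rfl fun j _ => hj j, Finset.prod_boole]
  have : failureSet o = Finset.univ.filter (fun j : Fin N => N - i ≤ (j : ℕ)) ↔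
      ∀ j ∈ Finset.univ, (o (Fin.castSucc j) = 2 ↔ N - i ≤ (j : ℕ)) := by
    simp [Finset.ext_iff, failureSet]
  simp only [this]
  split_ifs <;> simp

/-- The accept weight in terms of the outcome distribution of the refined test. -/
theorem testWeight_strategy_eq_sum (lam : ℝ) (Ψ : EuclideanSpace ℂ ι) {k N : ℕ}
    {ρ : Matrix (Fin (N + 1) → ι) (Fin (N + 1) → ι) ℂ} (hρ : IsPermInvariant ρ)
    (r : Fin 3 → ℝ) :
    testWeight (strategy lam Ψ) (∑ a, (r a : ℂ) • refinedEffect lam Ψ a) k N ρ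
      = ∑ o, (if (failureSet o).card ≤ k then r (o (Fin.last N)) else 0)
          * outcomeProb lam Ψ ρ o := by
  have hi : ∀ i, (N.choose i : ℝ) * (testOp (strategy lam Ψ)
      (∑ a, (r a : ℂ) • refinedEffect lam Ψ a) N i * ρ).trace.re
      = ∑ o, (if (failureSet o).card = i then r (o (Fin.last N)) else 0)
          * outcomeProb lam Ψ ρ o := by
    intro i
    rcases le_or_gt i N with h | h
    · rw [re_trace_testOp_mul]
      have := choose_mul_sum_failureSet lam Ψ hρ r
        (Finset.univ.filter (fun j : Fin N => N - i ≤ (j : ℕ)))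
      rwa [card_filter_sub_le h] at this
    · rw [Nat.choose_eq_zero_of_lt h, Nat.cast_zero, zero_mul, eq_comm]
      refine Finset.sum_eq_zero fun o _ => ?_
      have h2 := (failureSet o).card_le_univ
      rw [Fintype.card_fin] at h2
      rw [if_neg (by omega), zero_mul]
  unfold testWeight
  rw [Finset.sum_congr rfl fun i _ => hi i, Finset.sum_comm]
  refine Finset.sum_congr rfl fun o _ => ?_
  rw [← Finset.sum_mul, Finset.sum_ite_eq]
  simp

end OutcomeDistribution

/-! ### Upper bound by exponential weights. -/

section UpperBound

set_option linter.unusedSectionVars false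

variable {ι : Type*} [Fintype ι] [DecidableEq ι] {m : ℕ}

/-- The total number of failures. -/
def failureCount (o : Fin m → Fin 3) : ℕ := (Finset.univ.filter fun j => o j = 2).card

/-- The number of systems orthogonal to the target that pass the test. -/
def falsePassCount (o : Fin m → Fin 3) : ℕ := (Finset.univ.filter fun j => o j = 1).card

theorem failureCount_comp (o : Fin m → Fin 3) (π : Equiv.Perm (Fin m)) :
    failureCount (o ∘ π) = failureCount o := by
  simp only [failureCount, Finset.card_filter, Function.comp_apply]
  exact Equiv.sum_comp π fun j => if o j = 2 then 1 else 0

theorem failureCount_eq_card_failureSet_add {N : ℕ} (o : Fin (N + 1) → Fin 3) :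
    failureCount o = (failureSet o).card + if o (Fin.last N) = 2 then 1 else 0 := by
  simp only [failureCount, failureSet, Finset.card_filter, Fin.sum_univ_castSucc]

theorem sum_refinedEffect_eq_one (lam : ℝ) (Ψ : EuclideanSpace ℂ ι) :
    ∑ a, ((1 : ℝ) : ℂ) • refinedEffect lam Ψ a = 1 := by
  simp [Fin.sum_univ_three, refinedEffect, sub_smul]

/-- The hypothesis makes the weighted effects sum to the identity on each factor, so the exponential
moment is the trace of `ρ`, with no independence assumed. -/
theorem sum_exp_mul_outcomeProb {lam : ℝ} (Ψ : EuclideanSpace ℂ ι)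
    {ρ : Matrix (Fin m → ι) (Fin m → ι) ℂ} (hρ : ρ.trace = 1) {α θ : ℝ}
    (h : lam * Real.exp α + (1 - lam) * Real.exp (-θ) = 1) :
    ∑ o : Fin m → Fin 3, Real.exp (α * falsePassCount o - θ * failureCount o)
      * outcomeProb lam Ψ ρ o = 1 := by
  let g : Fin 3 → ℝ := ![1, Real.exp α, Real.exp (-θ)]
  have hg : ∑ a, (g a : ℂ) • refinedEffect lam Ψ a = 1 := by
    have h' : (lam : ℂ) * Real.exp α + (1 - lam) * Real.exp (-θ) = 1 := by exact_mod_cast h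
    have : ∑ a, (g a : ℂ) • refinedEffect lam Ψ a = rankOneProj Ψ +
        ((lam : ℂ) * Real.exp α + (1 - lam) * Real.exp (-θ)) • (1 - rankOneProj Ψ) := by
      simp only [Fin.sum_univ_three, refinedEffect, g, Matrix.cons_val]
      rw [smul_smul, smul_smul, add_smul, add_assoc, mul_comm (lam : ℂ), mul_comm (1 - (lam : ℂ))]
      simp
    rw [this, h', one_smul, add_sub_cancel]
  have key := re_trace_tensorOp_sum_smul_mul lam Ψ ρ fun _ => g
  rw [hg] at key
  have hone : tensorOp (fun _ : Fin m => (1 : Matrix ι ι ℂ)) = 1 := by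
    ext x y
    simp only [tensorOp, Matrix.of_apply, Matrix.one_apply, Finset.prod_boole, funext_iff,
      Finset.mem_univ, true_imp_iff]
  rw [hone, one_mul, hρ, Complex.one_re] at key
  rw [key]
  refine Finset.sum_congr rfl fun o _ => ?_
  congr 1
  have hj : ∀ j, g (o j)
      = Real.exp (α * (if o j = 1 then 1 else 0) - θ * if o j = 2 then 1 else 0) := by
    intro j
    generalize o j = a
    fin_cases a <;> simp [g]
  simp only [hj, ← Real.exp_sum, Finset.sum_sub_distrib, ← Finset.mul_sum, falsePassCount,
    failureCount, Finset.card_filter, Nat.cast_sum, Nat.cast_ite, Nat.cast_one, Nat.cast_zero]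

theorem acceptProb_eq_sum (lam : ℝ) (Ψ : EuclideanSpace ℂ ι) {k N : ℕ}
    {ρ : Matrix (Fin (N + 1) → ι) (Fin (N + 1) → ι) ℂ} (hρ : IsPermInvariant ρ) :
    acceptProb lam Ψ k N ρ
      = ∑ o, (if (failureSet o).card ≤ k then 1 else 0) * outcomeProb lam Ψ ρ o := by
  rw [acceptProb, ← sum_refinedEffect_eq_one lam Ψ]
  exact testWeight_strategy_eq_sum lam Ψ hρ fun _ => 1

/-- Up to the factor `lam`, the infidelity is the weight of acceptance with a false pass of the
remaining system. -/
theorem mul_acceptProb_sub_testWeight (lam : ℝ) (Ψ : EuclideanSpace ℂ ι) {k N : ℕ}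
    {ρ : Matrix (Fin (N + 1) → ι) (Fin (N + 1) → ι) ℂ} (hρ : IsPermInvariant ρ) :
    lam * (acceptProb lam Ψ k N ρ - testWeight (strategy lam Ψ) (rankOneProj Ψ) k N ρ)
      = ∑ o, (if (failureSet o).card ≤ k then if o (Fin.last N) = 1 then 1 else 0 else 0)
          * outcomeProb lam Ψ ρ o := by
  have h0 : testWeight (strategy lam Ψ) (rankOneProj Ψ) k N ρ
      = ∑ o, (if (failureSet o).card ≤ k then if o (Fin.last N) = 0 then 1 else 0 else 0)
          * outcomeProb lam Ψ ρ o := by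
    rw [← testWeight_strategy_eq_sum lam Ψ hρ fun a => if a = 0 then 1 else 0]
    simp [refinedEffect]
  have h1 := testWeight_strategy_eq_sum lam Ψ (k := k) hρ fun a => if a = 1 then 1 else 0
  -- Weight `lam` on outcomes `1` and `2` yields the operator `λ(1 - P)`, which is also the effect
  -- of outcome `1` alone. The two weightings therefore have the same expectation.
  have h2 := testWeight_strategy_eq_sum lam Ψ (k := k) hρ fun a => if a = 0 then 0 else lam
  have h3 : ∑ a : Fin 3, ((if a = 0 then 0 else lam : ℝ) : ℂ) • refinedEffect lam Ψ a
      = ∑ a : Fin 3, ((if a = 1 then 1 else 0 : ℝ) : ℂ) • refinedEffect lam Ψ a := by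
    simp only [Fin.sum_univ_three, refinedEffect, Matrix.cons_val]
    simp only [one_ne_zero, if_false, if_true, Fin.reduceEq, Complex.ofReal_zero,
      Complex.ofReal_one, zero_smul, zero_add, smul_smul, ← add_smul]
    congr 1
    push_cast
    ring
  rw [← h1, ← h3, h2, acceptProb_eq_sum lam Ψ hρ, h0, ← Finset.sum_sub_distrib, Finset.mul_sum]
  refine Finset.sum_congr rfl fun o _ => ?_
  split_ifs <;> ring

/-- Swapping system `j` with the last one shows that every `j` contributes equally. When the last
outcome is a false pass it is not a failure, so counting failures on `N` or on `N + 1` systems is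
the same. -/
theorem sum_falsePass_last (lam : ℝ) (Ψ : EuclideanSpace ℂ ι) {k N : ℕ}
    {ρ : Matrix (Fin (N + 1) → ι) (Fin (N + 1) → ι) ℂ} (hρ : IsPermInvariant ρ) :
    (N + 1 : ℝ) * ∑ o, (if (failureSet o).card ≤ k then
        if o (Fin.last N) = 1 then 1 else 0 else 0) * outcomeProb lam Ψ ρ o
      = ∑ o, (if failureCount o ≤ k then (falsePassCount o : ℝ) else 0)
          * outcomeProb lam Ψ ρ o := by
  have hj : ∀ j : Fin (N + 1),
      ∑ o, (if (failureSet o).card ≤ k then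
        if o (Fin.last N) = 1 then 1 else 0 else 0) * outcomeProb lam Ψ ρ o
      = ∑ o, (if failureCount o ≤ k then if o j = 1 then 1 else 0 else 0)
          * outcomeProb lam Ψ ρ o := by
    intro j
    rw [← sum_outcomeProb_comp lam Ψ hρ (Equiv.swap j (Fin.last N))
      fun o => if failureCount o ≤ k then if o j = 1 then 1 else 0 else 0]
    refine Finset.sum_congr rfl fun o _ => ?_
    rw [failureCount_comp, Function.comp_apply, Equiv.swap_apply_left,
      failureCount_eq_card_failureSet_add]
    by_cases h : o (Fin.last N) = 1 <;> simp [h]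
  have := Finset.sum_congr (rfl : (Finset.univ : Finset (Fin (N + 1))) = _) fun j _ => hj j
  rw [Finset.sum_const, Finset.card_univ, Fintype.card_fin, nsmul_eq_mul, Nat.cast_succ,
    Finset.sum_comm] at this
  rw [this]
  refine Finset.sum_congr rfl fun o _ => ?_
  rw [← Finset.sum_mul]
  congr 1
  split_ifs
  · simp [falsePassCount]
  · simp

/-- With `L = log δ⁻¹`, the inequality `δ e^y = e^(y - L) ≥ y + 1 - L` at `y = αF - θZ` makes the
exponential moment linear in `F`. No large-deviation estimate for the state is needed. -/
theorem mul_one_sub_condFidelity_le {lam : ℝ} (hlam : 0 < lam) (hlam1 : lam < 1)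
    {Ψ : EuclideanSpace ℂ ι} (hΨ : ‖Ψ‖ = 1) {k N : ℕ} {δ : ℝ} (hδ : 0 < δ) (hδ1 : δ ≤ 1 / 4)
    {ρ : Matrix (Fin (N + 1) → ι) (Fin (N + 1) → ι) ℂ} (hs : IsState ρ) (hρ : IsPermInvariant ρ)
    (hp : δ ≤ acceptProb lam Ψ k N ρ) {α θ : ℝ} (hθ : 0 ≤ θ)
    (h : lam * Real.exp α + (1 - lam) * Real.exp (-θ) = 1) :
    α * lam * (N + 1) * (1 - condFidelity lam Ψ k N ρ) ≤ Real.log δ⁻¹ + θ * k := by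
  set L := Real.log δ⁻¹ with hL
  -- This needs only `δ ≤ 1/e`. It makes `L - 1` nonnegative, so that `p'` can be enlarged to `p` in
  -- `hfin`.
  have hL1 : 1 ≤ L := by
    rw [hL, Real.le_log_iff_exp_le (by positivity)]
    have h4 : (4 : ℝ) ≤ δ⁻¹ := by
      rw [le_inv_comm₀ (by norm_num) hδ]; linarith
    linarith [Real.exp_one_lt_d9]
  have hexpL : Real.exp (-L) = δ := by
    rw [Real.exp_neg, hL, Real.exp_log (by positivity), inv_inv]
  set p := acceptProb lam Ψ k N ρ with hpdef
  have hp0 : 0 < p := hδ.trans_le hp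
  set q := outcomeProb lam Ψ ρ
  have hq : ∀ o, 0 ≤ q o := outcomeProb_nonneg hlam.le hlam1.le hΨ hs.1
  set W : ℝ := ∑ o, (if failureCount o ≤ k then (falsePassCount o : ℝ) else 0) * q o with hW
  set p' : ℝ := ∑ o, (if failureCount o ≤ k then 1 else 0) * q o with hp'
  have hpp : p' ≤ p := by
    rw [hpdef, acceptProb_eq_sum lam Ψ hρ]
    refine Finset.sum_le_sum fun o _ => mul_le_mul_of_nonneg_right ?_ (hq o)
    have := failureCount_eq_card_failureSet_add o
    split_ifs <;> first | omega | norm_num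
  have hp0' : 0 ≤ p' := Finset.sum_nonneg fun o _ =>
    mul_nonneg (by split_ifs <;> norm_num) (hq o)
  have hexp := sum_exp_mul_outcomeProb Ψ hs.2 h
  have hmain : α * W - θ * k * p' + (1 - L) * p' ≤ δ := by
    calc α * W - θ * k * p' + (1 - L) * p'
        ≤ ∑ o, δ * (Real.exp (α * falsePassCount o - θ * failureCount o) * q o) := by
          rw [hW, hp', Finset.mul_sum, Finset.mul_sum, Finset.mul_sum, ← Finset.sum_sub_distrib,
            ← Finset.sum_add_distrib]
          refine Finset.sum_le_sum fun o _ => ?_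
          have h1 : δ * Real.exp (α * falsePassCount o - θ * failureCount o)
              = Real.exp (α * falsePassCount o - θ * failureCount o + -L) := by
            rw [Real.exp_add, hexpL, mul_comm]
          rw [← mul_assoc δ, h1]
          -- On the event `Z ≤ k` the tangent line at `0` is used together with `θZ ≤ θk`; elsewhere
          -- the exponential is merely nonnegative.
          split_ifs with hk
          · have h2 := Real.add_one_le_exp
              (α * (falsePassCount o : ℝ) - θ * failureCount o + -L)
            have h3 : θ * (failureCount o : ℝ) ≤ θ * k :=
              mul_le_mul_of_nonneg_left (by exact_mod_cast hk) hθ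
            nlinarith [hq o]
          · have := mul_nonneg (Real.exp_nonneg
              (α * falsePassCount o - θ * failureCount o + -L)) (hq o)
            simpa using this
      _ = δ := by rw [← Finset.mul_sum, hexp, mul_one]
  have hnum : lam * (N + 1) * ((1 - condFidelity lam Ψ k N ρ) * p) = W := by
    rw [hW, ← sum_falsePass_last lam Ψ hρ, ← mul_acceptProb_sub_testWeight lam Ψ hρ]
    rw [condFidelity, sub_mul, div_mul_cancel₀ _ hp0.ne']
    ring
  have hfin : α * W ≤ (L + θ * k) * p := by
    have : 0 ≤ θ * k := by positivity
    nlinarith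
  rw [← hnum] at hfin
  exact le_of_mul_le_mul_right (by linarith) hp0

/-- Hoeffding's lemma for a Bernoulli variable. -/
theorem bernoulli_mgf_le {lam : ℝ} (h0 : 0 ≤ lam) (h1 : lam ≤ 1) (t : ℝ) :
    lam * Real.exp t + (1 - lam) ≤ Real.exp (lam * t + t ^ 2 / 8) := by
  open MeasureTheory ProbabilityTheory in
  let μ : Measure ℝ :=
    ENNReal.ofReal lam • Measure.dirac 1 + ENNReal.ofReal (1 - lam) • Measure.dirac 0
  have hint : ∀ f : ℝ → ℝ, ∫ x, f x ∂μ = lam * f 1 + (1 - lam) * f 0 := by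
    intro f
    rw [integral_add_measure, integral_smul_measure, integral_smul_measure, integral_dirac,
      integral_dirac, ENNReal.toReal_ofReal h0, ENNReal.toReal_ofReal (by linarith), smul_eq_mul,
      smul_eq_mul]
    · exact (integrable_dirac (by simp)).smul_measure ENNReal.ofReal_ne_top
    · exact (integrable_dirac (by simp)).smul_measure ENNReal.ofReal_ne_top
  have : IsProbabilityMeasure μ := ⟨by
    simp only [μ, Measure.add_apply, Measure.smul_apply, measure_univ, smul_eq_mul, mul_one]
    rw [← ENNReal.ofReal_add h0 (by linarith)]
    simp⟩
  have hb : ∀ᵐ x ∂μ, id x ∈ Set.Icc (0 : ℝ) 1 := by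
    rw [ae_add_measure_iff]
    constructor <;> refine Measure.ae_smul_measure ?_ _ <;> rw [ae_dirac_eq] <;> simp
  -- An interval of length `1` has variance proxy `1/4`, whence the exponent `t²/8`. The bound is
  -- for the variable centred at its mean `lam`.
  have key := (hasSubgaussianMGF_of_mem_Icc (X := id) aemeasurable_id hb).mgf_le t
  simp only [mgf, hint] at key
  simp only [id, mul_one, mul_zero, add_zero, sub_zero, zero_sub, nnnorm_one, NNReal.coe_pow,
    NNReal.coe_div, NNReal.coe_one, NNReal.coe_ofNat] at key
  have e1 : lam * Real.exp t + (1 - lam)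
      = Real.exp (lam * t) * (lam * Real.exp (t * (1 - lam)) + (1 - lam) * Real.exp (t * -lam)) := by
    rw [mul_add, mul_left_comm, ← Real.exp_add, mul_left_comm, ← Real.exp_add]
    have e2 : lam * t + t * (1 - lam) = t := by ring
    have e3 : lam * t + t * -lam = 0 := by ring
    rw [e2, e3, Real.exp_zero, mul_one]
  rw [e1, Real.exp_add]
  refine mul_le_mul_of_nonneg_left (key.trans_eq ?_) (Real.exp_nonneg _)
  congr 1
  ring

/-- The form of the upper bound in which the tail parameter `t` is still free. -/
theorem guaranteedInfidelity_mul_le {lam : ℝ} (hlam : 0 < lam) (hlam1 : lam < 1)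
    {Ψ : EuclideanSpace ℂ ι} (hΨ : ‖Ψ‖ = 1) {k N : ℕ} {δ : ℝ} (hδ : 0 < δ) (hδ1 : δ ≤ 1 / 4)
    {t : ℝ} (ht : 0 ≤ t) (ht1 : t < 8 * (1 - lam)) :
    guaranteedInfidelity lam Ψ k N δ * (lam * (N + 1) * ((1 - lam) * t - t ^ 2 / 8))
      ≤ Real.log δ⁻¹ + (lam * t + t ^ 2 / 8) * k := by
  obtain ⟨ρ, hs, hρ, hp, hF⟩ :=
    (isLeast_one_sub_guaranteedInfidelity lam hΨ k N hδ (by linarith : δ ≤ 1)).1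
  have hε : guaranteedInfidelity lam Ψ k N δ = 1 - condFidelity lam Ψ k N ρ := by linarith
  set ε := guaranteedInfidelity lam Ψ k N δ
  set θ := lam * t + t ^ 2 / 8 with hθ
  have hθ0 : 0 ≤ θ := by positivity
  have hb := bernoulli_mgf_le hlam.le hlam1.le t
  rw [← hθ] at hb
  have hx : Real.exp (t - θ) ≤ (1 - (1 - lam) * Real.exp (-θ)) / lam := by
    rw [le_div_iff₀ hlam, sub_eq_add_neg, Real.exp_add]
    have : Real.exp θ * Real.exp (-θ) = 1 := by rw [← Real.exp_add]; simp
    nlinarith [Real.exp_pos (-θ)]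
  -- `x` is the value of `e^α` forced by the constraint for this `θ`; Hoeffding's lemma gives `α =
  -- log x ≥ t - θ = νt - t²/8`.
  set x := (1 - (1 - lam) * Real.exp (-θ)) / lam with hxdef
  have hx0 : 0 < x := (Real.exp_pos _).trans_le hx
  have hα : t - θ ≤ Real.log x := (Real.le_log_iff_exp_le hx0).mpr hx
  have h : lam * Real.exp (Real.log x) + (1 - lam) * Real.exp (-θ) = 1 := by
    rw [Real.exp_log hx0, hxdef]; field_simp; ring
  have hmain := mul_one_sub_condFidelity_le hlam hlam1 hΨ hδ hδ1 hs hρ hp hθ0 h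
  rw [← hε] at hmain
  -- Replacing `log x` by its lower bound requires `ε ≥ 0`; for `ε ≤ 0` the left side is nonpositive
  -- because `t < 8ν`.
  rcases le_or_gt ε 0 with h0 | h0
  · have h1 : 0 ≤ lam * (N + 1 : ℝ) * ((1 - lam) * t - t ^ 2 / 8) :=
      mul_nonneg (by positivity) (by nlinarith)
    have h2 : 0 ≤ Real.log δ⁻¹ := Real.log_nonneg (by
      rw [one_le_inv₀ hδ]; linarith)
    have h3 : 0 ≤ θ * k := by positivity
    nlinarith
  · refine le_trans ?_ hmain
    have h1 : 0 ≤ ε * (lam * (N + 1 : ℝ)) := by positivity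
    have h2 : (1 - lam) * t - t ^ 2 / 8 ≤ Real.log x := by rw [hθ] at hα; linarith
    nlinarith [mul_le_mul_of_nonneg_left h2 h1]

theorem guaranteedInfidelity_le {lam : ℝ} (hlam : 0 < lam) (hlam1 : lam < 1)
    {Ψ : EuclideanSpace ℂ ι} (hΨ : ‖Ψ‖ = 1) {k N : ℕ} {δ : ℝ} (hδ : 0 < δ) (hδ1 : δ ≤ 1 / 4)
    (hN : 1 ≤ N) {s : ℝ} (hs : 0 < s) (hk : (k : ℝ) ≤ (1 - lam) * s * N) :
    guaranteedInfidelity lam Ψ k N δ ≤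
      s + 1 / ((1 - lam) * lam) * √(s * Real.log δ⁻¹ / N)
        + Real.log δ⁻¹ / (2 * (1 - lam) ^ 2 * lam * N) := by
  have hN0 : (0 : ℝ) < N := by exact_mod_cast hN
  have hν : 0 < 1 - lam := by linarith
  set ν := 1 - lam with hνdef
  have hL : 0 < Real.log δ⁻¹ := Real.log_pos (by rw [one_lt_inv₀ hδ]; linarith)
  set L := Real.log δ⁻¹ with hLdef
  set l := L / N with hl
  have hl0 : 0 < l := by positivity
  have hLl : L = l * N := by rw [hl]; field_simp
  set u := √(s * L / N) with hu
  have hu0 : 0 < u := by positivity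
  have hu2 : u ^ 2 = s * l := by rw [hu, Real.sq_sqrt (by positivity), hl]; ring
  -- `D` is `lam` times the claimed excess over `s`.
  set D := u / ν + l / (2 * ν ^ 2) with hD
  have hD0 : 0 < D := by positivity
  have hgoal : s + 1 / (ν * lam) * u + L / (2 * ν ^ 2 * lam * N) = s + D / lam := by
    rw [hD, hl]; field_simp; ring
  rw [hgoal]
  -- This maximises `tDν - t²(s + D)/8`, the gap left in `hquad` before `l` is accounted for; the
  -- maximum is `2ν²D²/(s + D)`, and `hdisc` says that it is at least `l`.
  set t := 4 * ν * D / (s + D) with htdef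
  have ht0 : 0 < t := by positivity
  have ht4 : t < 4 * ν := by
    rw [htdef, div_lt_iff₀ (by positivity)]; nlinarith [mul_pos hν hs]
  have hmain := guaranteedInfidelity_mul_le hlam hlam1 hΨ (k := k) (N := N) hδ hδ1 ht0.le
    (by linarith : t < 8 * (1 - lam))
  rw [← hνdef, ← hLdef] at hmain
  set ε := guaranteedInfidelity lam Ψ k N δ
  have hden : 0 < ν * t - t ^ 2 / 8 := by nlinarith
  have hdisc : l * (s + D) ≤ 2 * ν ^ 2 * D ^ 2 := by
    have e : ν * D = u + l / (2 * ν) := by rw [hD]; field_simp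
    have e2 : 2 * ν ^ 2 * D ^ 2 = 2 * (u + l / (2 * ν)) ^ 2 := by rw [← e]; ring
    have e3 : l * D = l * u / ν + 2 * (l / (2 * ν)) ^ 2 := by rw [hD]; field_simp
    have e4 : 2 * (u * (l / (2 * ν))) = l * u / ν := by field_simp
    have e5 : 0 < l * u / ν := by positivity
    have e6 : 2 * (u + l / (2 * ν)) ^ 2
        = 2 * u ^ 2 + 2 * (2 * (u * (l / (2 * ν)))) + 2 * (l / (2 * ν)) ^ 2 := by ring
    rw [e2, mul_add, e3, e6, e4, hu2]
    linarith [mul_pos hs hl0]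
  -- the quadratic inequality at its optimal point
  have hquad : l + (lam * t + t ^ 2 / 8) * (ν * s)
      ≤ (s + D / lam) * (lam * (ν * t - t ^ 2 / 8)) := by
    have e1 : (s + D / lam) * (lam * (ν * t - t ^ 2 / 8))
        = (s * lam + D) * (ν * t - t ^ 2 / 8) := by field_simp
    have e2 : t * (s + D) = 4 * ν * D := by rw [htdef]; field_simp
    have e3 : t * D * ν = t ^ 2 * (s + D) / 4 := by
      linear_combination (-t / 4) * e2
    have e4 : l ≤ t ^ 2 * (s + D) / 8 := by
      have : t ^ 2 * (s + D) / 8 = 2 * ν ^ 2 * D ^ 2 / (s + D) := by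
        rw [htdef]; field_simp; norm_num
      rw [this, le_div_iff₀ (by positivity)]
      exact hdisc
    have e5 : lam = 1 - ν := by rw [hνdef]; ring
    rw [e1]
    have : (s * lam + D) * (ν * t - t ^ 2 / 8) - (lam * t + t ^ 2 / 8) * (ν * s)
        = t * D * ν - t ^ 2 * (s + D) / 8 := by rw [e5]; ring
    linarith
  -- The contrary assumption also makes `ε` positive, which is what permits passing from `N + 1` to
  -- `N` with a strict inequality.
  by_contra! hlt
  have hX : 0 < lam * (ν * t - t ^ 2 / 8) := by positivity
  have hE0 : 0 < s + D / lam := by positivity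
  have h1 : (s + D / lam) * (lam * (ν * t - t ^ 2 / 8)) * N
      < ε * (lam * (N + 1) * (ν * t - t ^ 2 / 8)) := by
    have := mul_lt_mul_of_pos_right hlt (mul_pos hX hN0)
    have h2 : 0 < ε * (lam * (ν * t - t ^ 2 / 8)) := mul_pos (hE0.trans hlt) hX
    have h3 : ε * (lam * (N + 1) * (ν * t - t ^ 2 / 8))
        = ε * (lam * (ν * t - t ^ 2 / 8) * N) + ε * (lam * (ν * t - t ^ 2 / 8)) := by ring
    rw [h3, mul_assoc]
    linarith
  have h3 : L + (lam * t + t ^ 2 / 8) * k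
      ≤ (l + (lam * t + t ^ 2 / 8) * (ν * s)) * N := by
    rw [hLl]
    have := mul_le_mul_of_nonneg_left hk (by positivity : 0 ≤ lam * t + t ^ 2 / 8)
    have e : (l + (lam * t + t ^ 2 / 8) * (ν * s)) * N
        = l * N + (lam * t + t ^ 2 / 8) * (ν * s * N) := by ring
    rw [e]
    exact add_le_add_right this _
  have h4 := mul_le_mul_of_nonneg_right hquad hN0.le
  linarith

end UpperBound

/-! ### An integer binomial mean `k` has at least half of the mass at or below it. -/

section BinomialMedian

/-- The probability of at most `k` successes in `n` Bernoulli trials with success probability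
`t`. -/
noncomputable def binomialCDF (n k : ℕ) (t : ℝ) : ℝ :=
  ∑ i ∈ Finset.range (k + 1), (n.choose i : ℝ) * t ^ i * (1 - t) ^ (n - i)

theorem binomialCDF_eq_eval (n k : ℕ) (t : ℝ) :
    binomialCDF n k t
      = (∑ i ∈ Finset.range (k + 1), bernsteinPolynomial ℝ n i).eval t := by
  simp [binomialCDF, bernsteinPolynomial, Polynomial.eval_finsetSum]

theorem derivative_sum_bernsteinPolynomial (n k : ℕ) :
    Polynomial.derivative (∑ i ∈ Finset.range (k + 1), bernsteinPolynomial ℝ n i)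
      = -n * bernsteinPolynomial ℝ (n - 1) k := by
  induction k with
  | zero => simp [bernsteinPolynomial.derivative_zero]
  | succ k ih =>
    rw [Finset.sum_range_succ, Polynomial.derivative_add, ih, bernsteinPolynomial.derivative_succ]
    ring

theorem hasDerivAt_binomialCDF (n k : ℕ) (t : ℝ) :
    HasDerivAt (binomialCDF n k)
      (-(n * ((n - 1).choose k * t ^ k * (1 - t) ^ (n - 1 - k)))) t := by
  have h := (∑ i ∈ Finset.range (k + 1), bernsteinPolynomial ℝ n i).hasDerivAt t
  rw [derivative_sum_bernsteinPolynomial] at h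
  have e : binomialCDF n k
      = fun t => (∑ i ∈ Finset.range (k + 1), bernsteinPolynomial ℝ n i).eval t :=
    funext (binomialCDF_eq_eval n k)
  rw [e]
  refine h.congr_deriv ?_
  simp [bernsteinPolynomial]

/-- The expansion `a (log(a + y) - log(a - y)) = 2y ∑ (y/a)^(2i)/(2i + 1)` is termwise decreasing in
`a`. -/
theorem mul_log_sub_log_le {a b y : ℝ} (hy : 0 ≤ y) (ha : y < a) (hab : a ≤ b) :
    b * (Real.log (b + y) - Real.log (b - y)) ≤ a * (Real.log (a + y) - Real.log (a - y)) := by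
  have ha0 : 0 < a := hy.trans_lt ha
  have hb0 : 0 < b := ha0.trans_le hab
  have hs : ∀ c, y < c → 0 < c → HasSum (fun i : ℕ => c * (2 * (1 / (2 * i + 1)) *
      (y / c) ^ (2 * i + 1))) (c * (Real.log (c + y) - Real.log (c - y))) := by
    intro c hc hc0
    have h := (Real.hasSum_log_sub_log_of_abs_lt_one (x := y / c) (by
      rw [abs_of_nonneg (by positivity), div_lt_one hc0]; exact hc)).mul_left c
    have h1 : 1 + y / c = (c + y) / c := by field_simp
    have h2 : 1 - y / c = (c - y) / c := by field_simp
    rw [h1, h2, Real.log_div (by positivity) hc0.ne', Real.log_div (by linarith) hc0.ne'] at h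
    rwa [sub_sub_sub_cancel_right] at h
  refine hasSum_le (fun i => ?_) (hs b (ha.trans_le hab) hb0) (hs a ha ha0)
  have e : ∀ c : ℝ, 0 < c → c * (2 * (1 / (2 * (i : ℝ) + 1)) * (y / c) ^ (2 * i + 1))
      = 2 * (1 / (2 * (i : ℝ) + 1)) * y * (y / c) ^ (2 * i) := by
    intro c hc
    rw [pow_succ]
    field_simp
  rw [e a ha0, e b hb0]
  gcongr

/-- After taking logarithms this is `mul_log_sub_log_le` with `a = k`, `b = m`; the exponent `m - 1`
in place of `m` only helps. It compares the slopes of the distribution function at points symmetric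
about the mean. -/
theorem sub_pow_mul_add_pow_le {k m : ℕ} (hkm : k ≤ m) {y : ℝ} (hy : 0 ≤ y) (hk : y ≤ k)
    (hk0 : 0 < k) :
    ((k : ℝ) - y) ^ k * (m + y) ^ (m - 1) ≤ (k + y) ^ k * (m - y) ^ (m - 1) := by
  have hk0' : (0 : ℝ) < k := by exact_mod_cast hk0
  have hkm' : (k : ℝ) ≤ m := by exact_mod_cast hkm
  have hmy : 0 ≤ (m : ℝ) - y := by linarith
  rcases hk.eq_or_lt with h | h
  · rw [h, sub_self, zero_pow hk0.ne', zero_mul, ← h]; positivity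
  have hky' : 0 < (k : ℝ) - y := by linarith
  have hmy' : 0 < (m : ℝ) - y := by linarith
  have hm0' : (0 : ℝ) < m := hk0'.trans_le hkm'
  have h1 := mul_log_sub_log_le hy h hkm'
  have h2 : Real.log (m - y) ≤ Real.log (m + y) := Real.log_le_log hmy' (by linarith)
  have hm1 : ((m - 1 : ℕ) : ℝ) = m - 1 := by
    rw [Nat.cast_sub (by omega), Nat.cast_one]
  rw [← Real.log_le_log_iff (by positivity) (by positivity), Real.log_mul (by positivity)
    (by positivity), Real.log_mul (by positivity) (by positivity), Real.log_pow, Real.log_pow,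
    Real.log_pow, Real.log_pow, hm1]
  nlinarith

/-- If the mean `k` of a binomial distribution is an integer and the success probability is at most
`1 / 2`, then the probability of at most `k` successes is at least `1 / 2`. -/
theorem half_le_binomialCDF_of_two_mul_le {n k : ℕ} (hk : 0 < k) (hkn : 2 * k ≤ n) :
    1 / 2 ≤ binomialCDF n k (k / n) := by
  have hn0 : (0 : ℝ) < n := by exact_mod_cast (by omega : 0 < n)
  have hk0 : (0 : ℝ) < k := by exact_mod_cast hk
  have hkn' : 2 * (k : ℝ) ≤ n := by exact_mod_cast hkn
  obtain ⟨m, rfl⟩ : ∃ m, n = k + m := ⟨n - k, by omega⟩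
  set n := k + m with hn
  set p : ℝ := k / n with hp
  have hp0 : 0 < p := by positivity
  have hp2 : p * 2 ≤ 1 := by rw [hp, div_mul_eq_mul_div, div_le_one hn0]; linarith
  -- Symmetrising about `p` gives `G 0 = 2 binomialCDF n k p` and `G p = 1 + binomialCDF n k (2p) ≥
  -- 1`, the last since `2p ≤ 1`. It remains to see that `G` decreases.
  let G : ℝ → ℝ := fun x => binomialCDF n k (p - x) + binomialCDF n k (p + x)
  have hG : ∀ x, HasDerivAt G
      (n * (n - 1).choose k * ((p - x) ^ k * (1 - (p - x)) ^ (n - 1 - k)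
        - (p + x) ^ k * (1 - (p + x)) ^ (n - 1 - k))) x := by
    intro x
    have h1 := (hasDerivAt_binomialCDF n k (p - x)).comp x ((hasDerivAt_id x).const_sub p)
    have h2 := (hasDerivAt_binomialCDF n k (p + x)).comp x ((hasDerivAt_id x).const_add p)
    refine (h1.add h2).congr_deriv ?_
    ring
  have hanti : AntitoneOn G (Set.Icc 0 p) := by
    refine antitoneOn_of_deriv_nonpos (convex_Icc 0 p)
      (fun x _ => (hG x).continuousAt.continuousWithinAt)
      (fun x _ => (hG x).differentiableAt.differentiableWithinAt) fun x hx => ?_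
    rw [interior_Icc] at hx
    rw [(hG x).deriv]
    refine mul_nonpos_of_nonneg_of_nonpos (by positivity) (sub_nonpos.mpr ?_)
    have hnm : n - 1 - k = m - 1 := by omega
    have key := sub_pow_mul_add_pow_le (k := k) (m := m) (by omega) (y := n * x)
      (by have := hx.1; positivity) (by
        have := hx.2.le; rw [hp, le_div_iff₀ hn0] at this; linarith) hk
    have hmn : (m : ℝ) = n - k := by rw [hn]; push_cast; ring
    have e1 : p - x = (k - n * x) / n := by rw [hp]; field_simp
    have e2 : p + x = (k + n * x) / n := by rw [hp]; field_simp
    have e3 : 1 - (p - x) = (m + n * x) / n := by rw [hp, hmn]; field_simp; ring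
    have e4 : 1 - (p + x) = (m - n * x) / n := by rw [hp, hmn]; field_simp; ring
    rw [hnm, e3, e4, e1, e2, div_pow, div_pow, div_pow, div_pow, div_mul_div_comm,
      div_mul_div_comm]
    gcongr
  have h1 := hanti ⟨le_rfl, hp0.le⟩ ⟨hp0.le, le_rfl⟩ hp0.le
  simp only [G, sub_self, sub_zero, add_zero] at h1
  have h0 : binomialCDF n k 0 = 1 := by
    rw [binomialCDF, Finset.sum_eq_single 0]
    · simp
    · intro i _ hi; simp [hi]
    · simp
  have h2 : 0 ≤ binomialCDF n k (p + p) :=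
    Finset.sum_nonneg fun i _ => by
      have : 0 ≤ 1 - (p + p) := by linarith
      positivity
  linarith

/-- Comparison of the upper and the lower half of a sequence with the successive ratios of a binomial
distribution with mean `k`. -/
theorem le_of_binomial_ratio {k m : ℕ} (hm : 0 < m) (hkm : m ≤ k) (b : ℕ → ℝ)
    (hb0 : ∀ i, 0 ≤ b i)
    (hstep : ∀ i, i < k + m → b (i + 1) * ((i + 1) * m) = b i * ((k + m - i) * k)) :
    ∀ i, i < m → b (k + 1 + i) ≤ b (k - i) := by
  have hm0 : (0 : ℝ) < m := by exact_mod_cast hm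
  have hmk : (m : ℝ) ≤ k := by exact_mod_cast hkm
  have hk0 : (0 : ℝ) < k := hm0.trans_le hmk
  intro i
  induction i with
  | zero =>
    intro _
    have h := hstep k (by omega)
    have e : (k : ℝ) + m - k = m := by ring
    rw [e] at h
    simp only [add_zero, Nat.sub_zero]
    have h0 := hb0 (k + 1)
    have h1 : b (k + 1) * (k + 1) = b k * k := by
      have := mul_right_cancel₀ hm0.ne' (by linarith : b (k + 1) * (k + 1) * m = b k * k * m)
      exact this
    nlinarith
  | succ i ih =>
    intro hi
    have ih := ih (by omega)
    have hik : i + 1 ≤ k := by omega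
    have h1 := hstep (k + 1 + i) (by omega)
    have h2 := hstep (k - (i + 1)) (by omega)
    have e1 : k - (i + 1) + 1 = k - i := by omega
    have e2 : ((k - (i + 1) : ℕ) : ℝ) = k - (i + 1) := by
      rw [Nat.cast_sub hik]; push_cast; ring
    rw [e1, e2] at h2
    have e3 : ((k + 1 + i : ℕ) : ℝ) = k + 1 + i := by push_cast; ring
    rw [e3] at h1
    set r : ℝ := (i : ℝ) + 1 with hr
    have hr0 : 0 < r := by positivity
    have hrm : r < m := by rw [hr]; exact_mod_cast hi
    have h1' : b (k + 1 + (i + 1)) * ((k + 1 + r) * m) = b (k + 1 + i) * ((m - r) * k) := by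
      rw [← add_assoc]
      linear_combination h1
    have h2' : b (k - i) * ((k - r + 1) * m) = b (k - (i + 1)) * ((m + r) * k) := by
      linear_combination h2
    have hkr : 0 < (k : ℝ) - r + 1 := by linarith
    -- Right side minus left side equals `r²(k² - m²) + m²(2k + 1)`; this is where `m ≤ k` enters.
    have hcmp : (m - r) * k * ((m + r) * k) ≤ (k + 1 + r) * m * ((k - r + 1) * m) := by
      nlinarith [mul_nonneg (sq_nonneg r) (by nlinarith : (0 : ℝ) ≤ k ^ 2 - m ^ 2),
        mul_pos hk0 (pow_pos hm0 2), pow_pos hm0 2]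
    set x := b (k + 1 + (i + 1))
    set y := b (k - (i + 1))
    have hA : 0 < (k + 1 + r) * (m : ℝ) * ((k - r + 1) * m) := by positivity
    have hB : 0 ≤ (m - r) * (k : ℝ) * ((k - r + 1) * m) := by
      have : 0 ≤ (m : ℝ) - r := by linarith
      positivity
    refine le_of_mul_le_mul_right ?_ hA
    calc x * ((k + 1 + r) * m * ((k - r + 1) * m))
        = b (k + 1 + i) * ((m - r) * k) * ((k - r + 1) * m) := by rw [← h1']; ring
      _ ≤ b (k - i) * ((m - r) * k) * ((k - r + 1) * m) := by nlinarith
      _ = y * ((m - r) * k * ((m + r) * k)) := by linear_combination ((m - r) * k) * h2'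
      _ ≤ y * ((k + 1 + r) * m * ((k - r + 1) * m)) :=
        mul_le_mul_of_nonneg_left hcmp (hb0 _)

/-- If the mean `k` of a binomial distribution is an integer and the success probability is at least
`1 / 2`, then the probability of at most `k` successes is at least `1 / 2`. -/
theorem half_le_binomialCDF_of_le_two_mul {n k : ℕ} (hkn : k < n) (hnk : n ≤ 2 * k) :
    1 / 2 ≤ binomialCDF n k (k / n) := by
  obtain ⟨m, rfl⟩ : ∃ m, n = k + m := ⟨n - k, by omega⟩
  set n := k + m with hn
  have hm0 : (0 : ℝ) < m := by exact_mod_cast (by omega : 0 < m)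
  have hk0 : (0 : ℝ) < k := by exact_mod_cast (by omega : 0 < k)
  have hn0 : (0 : ℝ) < n := by exact_mod_cast (by omega : 0 < n)
  have hmk : (m : ℝ) ≤ k := by exact_mod_cast (by omega : m ≤ k)
  set p : ℝ := k / n with hp
  have hq : 1 - p = m / n := by rw [hp, hn]; push_cast; field_simp; ring
  have hp0 : 0 < p := by positivity
  have hq0 : 0 < 1 - p := by rw [hq]; positivity
  let b : ℕ → ℝ := fun i => (n.choose i : ℝ) * p ^ i * (1 - p) ^ (n - i)
  have hb0 : ∀ i, 0 ≤ b i := fun i => by positivity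
  have hstep : ∀ i, i < n → b (i + 1) * ((i + 1) * m) = b i * ((n - i) * k) := by
    intro i hi
    have hc : ((n.choose (i + 1) : ℕ) : ℝ) * (i + 1) = n.choose i * (n - i) := by
      have := Nat.choose_succ_right_eq n i
      rw [← Nat.cast_sub hi.le]
      exact_mod_cast this
    have hpow : (1 - p) ^ (n - i) = (1 - p) ^ (n - (i + 1)) * (1 - p) := by
      rw [← pow_succ]; congr 1; omega
    have hpq : p * m = (1 - p) * k := by rw [hq, hp]; ring
    simp only [b]
    rw [hpow, pow_succ]
    linear_combination (p ^ i * (1 - p) ^ (n - (i + 1)) * p * m) * hc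
      + (n.choose i * (n - i) * p ^ i * (1 - p) ^ (n - (i + 1))) * hpq
  have hpair := le_of_binomial_ratio (k := k) (m := m) (by omega) (by omega) b hb0 fun i hi => by
    rw [hstep i hi, hn, Nat.cast_add]
  have htot : ∑ i ∈ Finset.range (n + 1), b i = 1 := by
    have h := add_pow p (1 - p) n
    rw [add_sub_cancel, one_pow] at h
    rw [h]
    exact Finset.sum_congr rfl fun i _ => by simp only [b]; ring
  have hsplit : ∑ i ∈ Finset.range (n + 1), b i
      = binomialCDF n k p + ∑ i ∈ Finset.range m, b (k + 1 + i) := by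
    rw [show n + 1 = k + 1 + m by omega, Finset.sum_range_add]
    rfl
  -- The `m` terms above `k` are matched with `m` of the `k + 1` terms up to `k`, read downwards.
  have hle : ∑ i ∈ Finset.range m, b (k + 1 + i) ≤ binomialCDF n k p := by
    have hrefl : binomialCDF n k p = ∑ i ∈ Finset.range (k + 1), b (k - i) := by
      exact (Finset.sum_range_reflect b (k + 1)).symm
    rw [hrefl]
    calc ∑ i ∈ Finset.range m, b (k + 1 + i) ≤ ∑ i ∈ Finset.range m, b (k - i) :=
          Finset.sum_le_sum fun i hi => hpair i (Finset.mem_range.mp hi)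
      _ ≤ _ := Finset.sum_le_sum_of_subset_of_nonneg
          (Finset.range_subset_range.mpr (by omega)) fun i _ _ => hb0 _
  linarith

theorem half_le_binomialCDF {n k : ℕ} (hkn : k < n) : 1 / 2 ≤ binomialCDF n k (k / n) := by
  rcases Nat.eq_zero_or_pos k with rfl | hk
  · rw [binomialCDF]; norm_num
  · rcases le_total (2 * k) n with h | h
    · exact half_le_binomialCDF_of_two_mul_le hk h
    · exact half_le_binomialCDF_of_le_two_mul hkn h

end BinomialMedian

/-! ### Lower bound from product states. -/

section LowerBound

set_option linter.unusedSectionVars false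

variable {ι : Type*} [Fintype ι] [DecidableEq ι] {m : ℕ}

theorem isState_tensorOp_const {σ : Matrix ι ι ℂ} (hσ : IsState σ) (m : ℕ) :
    IsState (tensorOp fun _ : Fin m => σ) := by
  constructor
  · obtain ⟨B, rfl⟩ := exists_eq_conjTranspose_mul hσ.1
    rw [← tensorOp_mul_tensorOp, ← conjTranspose_tensorOp]
    exact Matrix.posSemidef_conjTranspose_mul_self _
  · rw [trace_tensorOp]; simp [hσ.2]

theorem isPermInvariant_tensorOp_const (σ : Matrix ι ι ℂ) (m : ℕ) :
    IsPermInvariant (tensorOp fun _ : Fin m => σ) :=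
  fun π x y => Equiv.prod_comp π fun j => σ (x j) (y j)

theorem trace_testOp_mul_tensorOp_const (Ω A σ : Matrix ι ι ℂ) {N i : ℕ} (hi : i ≤ N) :
    (testOp Ω A N i * tensorOp fun _ => σ).trace
      = (Ω * σ).trace ^ (N - i) * ((1 - Ω) * σ).trace ^ i * (A * σ).trace := by
  rw [testOp, tensorOp_mul_tensorOp, trace_tensorOp, Fin.prod_univ_castSucc]
  have h : ∀ j : Fin N, ((if ((j.castSucc : Fin (N + 1)) : ℕ) < N - i then Ω
      else if ((j.castSucc : Fin (N + 1)) : ℕ) < N then 1 - Ω else A) * σ).trace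
      = if N - i ≤ (j : ℕ) then ((1 - Ω) * σ).trace else (Ω * σ).trace := by
    intro j
    have := j.2
    simp only [Fin.val_castSucc, this, if_true]
    split_ifs <;> first | rfl | omega
  have h2 := Finset.card_filter_add_card_filter_not (s := (Finset.univ : Finset (Fin N)))
    (fun j => N - i ≤ (j : ℕ))
  rw [card_filter_sub_le hi, Finset.card_univ, Fintype.card_fin] at h2
  rw [Finset.prod_congr rfl fun j _ => h j, Finset.prod_ite, Finset.prod_const, Finset.prod_const,
    card_filter_sub_le hi, show (Finset.univ.filter fun j : Fin N => ¬ N - i ≤ (j : ℕ)).card = N - i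
      by omega, mul_comm (_ ^ i)]
  simp [show ¬ N < N - i by omega]

/-- For every `x ∈ [0, 1]` there is a state with infidelity `x`. -/
theorem exists_isState_trace_rankOneProj_mul [Nontrivial ι] {Ψ : EuclideanSpace ℂ ι}
    (hΨ : ‖Ψ‖ = 1) {x : ℝ} (h0 : 0 ≤ x) (h1 : x ≤ 1) :
    ∃ σ : Matrix ι ι ℂ, IsState σ ∧ (rankOneProj Ψ * σ).trace = ((1 - x : ℝ) : ℂ) := by
  have hd : 1 < Fintype.card ι := Fintype.one_lt_card
  have hd' : (0 : ℝ) < Fintype.card ι - 1 := by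
    rw [sub_pos]; exact_mod_cast hd
  have hP : (rankOneProj Ψ).PosSemidef := by
    have := Matrix.posSemidef_conjTranspose_mul_self (rankOneProj Ψ)
    rwa [conjTranspose_rankOneProj, rankOneProj_mul_self hΨ] at this
  have hQ : (1 - rankOneProj Ψ).PosSemidef := by
    have := Matrix.posSemidef_conjTranspose_mul_self (1 - rankOneProj Ψ)
    rwa [Matrix.conjTranspose_sub, conjTranspose_rankOneProj, Matrix.conjTranspose_one,
      one_sub_rankOneProj_mul_self hΨ] at this
  refine ⟨((1 - x : ℝ) : ℂ) • rankOneProj Ψ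
    + ((x / (Fintype.card ι - 1) : ℝ) : ℂ) • (1 - rankOneProj Ψ), ⟨?_, ?_⟩, ?_⟩
  · refine (hP.smul ?_).add (hQ.smul ?_)
    · exact_mod_cast sub_nonneg.mpr h1
    · exact_mod_cast div_nonneg h0 hd'.le
  · have hd2 : (Fintype.card ι : ℂ) - 1 ≠ 0 := by
      have := hd'.ne'
      exact_mod_cast this
    rw [Matrix.trace_add, Matrix.trace_smul, Matrix.trace_smul, Matrix.trace_sub,
      trace_rankOneProj hΨ, Matrix.trace_one, smul_eq_mul, smul_eq_mul]
    push_cast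
    field_simp
    ring
  · rw [mul_add, Matrix.mul_smul, Matrix.mul_smul, rankOneProj_mul_self hΨ, mul_sub, mul_one,
      rankOneProj_mul_self hΨ, sub_self, smul_zero, add_zero, Matrix.trace_smul,
      trace_rankOneProj hΨ, smul_eq_mul, mul_one]

theorem testWeight_strategy_tensorOp_const (lam : ℝ) {Ψ : EuclideanSpace ℂ ι} {σ : Matrix ι ι ℂ}
    (hσ : IsState σ) {x a : ℝ} (hx : (rankOneProj Ψ * σ).trace = ((1 - x : ℝ) : ℂ))
    {A : Matrix ι ι ℂ} (hA : (A * σ).trace = (a : ℂ)) (k N : ℕ) :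
    testWeight (strategy lam Ψ) A k N (tensorOp fun _ => σ)
      = binomialCDF N k ((1 - lam) * x) * a := by
  have h1 : (strategy lam Ψ * σ).trace = ((1 - (1 - lam) * x : ℝ) : ℂ) := by
    rw [strategy, add_mul, Matrix.smul_mul, sub_mul, one_mul, Matrix.trace_add, Matrix.trace_smul,
      Matrix.trace_sub, hx, hσ.2, smul_eq_mul]
    push_cast
    ring
  have h2 : ((1 - strategy lam Ψ) * σ).trace = (((1 - lam) * x : ℝ) : ℂ) := by
    rw [sub_mul, one_mul, Matrix.trace_sub, h1, hσ.2]
    push_cast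
    ring
  rw [testWeight, binomialCDF, Finset.sum_mul]
  refine Finset.sum_congr rfl fun i _ => ?_
  rcases le_or_gt i N with hi | hi
  · rw [trace_testOp_mul_tensorOp_const _ _ _ hi, h1, h2, hA, ← Complex.ofReal_pow,
      ← Complex.ofReal_pow, ← Complex.ofReal_mul, ← Complex.ofReal_mul, Complex.ofReal_re]
    ring
  · simp [Nat.choose_eq_zero_of_lt hi]

theorem div_le_guaranteedInfidelity [Nontrivial ι] {lam : ℝ} (hlam1 : lam < 1)
    {Ψ : EuclideanSpace ℂ ι} (hΨ : ‖Ψ‖ = 1) {k N : ℕ} {δ : ℝ} (hδ : 0 < δ) (hδ1 : δ ≤ 1 / 2)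
    (hk : (k : ℝ) ≤ (1 - lam) * N) (hkN : k < N) :
    k / ((1 - lam) * N) ≤ guaranteedInfidelity lam Ψ k N δ := by
  have hN : (0 : ℝ) < N := by exact_mod_cast (by omega : 0 < N)
  have hν : 0 < 1 - lam := by linarith
  -- This infidelity gives each test the failure probability `νx = k/N`, so the expected number of
  -- failures is exactly `k`.
  set x : ℝ := k / ((1 - lam) * N) with hx
  obtain ⟨σ, hσ, htr⟩ := exists_isState_trace_rankOneProj_mul hΨ (x := x) (by positivity)
    (by rw [hx, div_le_one (by positivity)]; exact hk)
  have hνx : (1 - lam) * x = k / N := by rw [hx]; field_simp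
  have hp : acceptProb lam Ψ k N (tensorOp fun _ => σ) = binomialCDF N k (k / N) := by
    rw [acceptProb, testWeight_strategy_tensorOp_const lam hσ htr (a := 1) (by simp [hσ.2]), hνx,
      mul_one]
  have hb := half_le_binomialCDF hkN
  have hF : condFidelity lam Ψ k N (tensorOp fun _ => σ) = 1 - x := by
    rw [condFidelity, hp, testWeight_strategy_tensorOp_const lam hσ htr htr, hνx,
      mul_div_cancel_left₀ _ (by linarith)]
  have hmem : 1 - x ∈ fidelitySet lam Ψ k N δ :=
    ⟨_, isState_tensorOp_const hσ _, isPermInvariant_tensorOp_const σ _, by rw [hp]; linarith,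
      hF.symm⟩
  have := (isLeast_one_sub_guaranteedInfidelity lam hΨ k N hδ (by linarith)).2 hmem
  linarith

end LowerBound

/-- `lam` is `λ`, and `1 - lam` is the spectral gap `ν` of the strategy. -/
theorem theorem1 {ι : Type*} [Fintype ι] [DecidableEq ι] [Nontrivial ι]
    (Ψ : EuclideanSpace ℂ ι) (hΨ : ‖Ψ‖ = 1) (s lam δ : ℝ)
    (hs : 0 < s) (hs1 : s < 1) (hlam : 0 < lam) (hlam1 : lam < 1) (hδ : 0 < δ) (hδ1 : δ ≤ 1 / 4) :
    (∀ N : ℕ, 1 ≤ N →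
      s - 1 / ((1 - lam) * N) <
          guaranteedInfidelity lam Ψ ⌊(1 - lam) * s * N⌋₊ N δ ∧
        guaranteedInfidelity lam Ψ ⌊(1 - lam) * s * N⌋₊ N δ ≤
          s + 1 / ((1 - lam) * lam) * √(s * Real.log δ⁻¹ / N)
            + Real.log δ⁻¹ / (2 * (1 - lam) ^ 2 * lam * N) + 2 / (lam * N)) ∧
    Filter.Tendsto (fun N : ℕ => guaranteedInfidelity lam Ψ ⌊(1 - lam) * s * N⌋₊ N δ)
      Filter.atTop (nhds s) := by
  have hν : 0 < 1 - lam := by linarith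
  have main : ∀ N : ℕ, 1 ≤ N →
      s - 1 / ((1 - lam) * N) <
          guaranteedInfidelity lam Ψ ⌊(1 - lam) * s * N⌋₊ N δ ∧
        guaranteedInfidelity lam Ψ ⌊(1 - lam) * s * N⌋₊ N δ ≤
          s + 1 / ((1 - lam) * lam) * √(s * Real.log δ⁻¹ / N)
            + Real.log δ⁻¹ / (2 * (1 - lam) ^ 2 * lam * N) + 2 / (lam * N) := by
    intro N hN
    have hN0 : (0 : ℝ) < N := by exact_mod_cast hN
    have hνN : 0 < (1 - lam) * (N : ℝ) := by positivity
    have hfloor : (⌊(1 - lam) * s * N⌋₊ : ℝ) ≤ (1 - lam) * s * N :=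
      Nat.floor_le (by positivity)
    have hfloor2 : (1 - lam) * s * N < ⌊(1 - lam) * s * N⌋₊ + 1 := Nat.lt_floor_add_one _
    -- Here `s < 1` enters: it gives `k ≤ νN`, so that `k/(νN)` is an admissible infidelity, and `k
    -- < N`.
    have hsN : (1 - lam) * s * N < (1 - lam) * N := by nlinarith
    constructor
    · refine lt_of_lt_of_le ?_ (div_le_guaranteedInfidelity hlam1 hΨ hδ (by linarith)
        (by linarith) ?_)
      · rw [sub_lt_iff_lt_add, ← add_div, lt_div_iff₀ hνN]
        linarith
      · have : (⌊(1 - lam) * s * N⌋₊ : ℝ) < N := by nlinarith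
        exact_mod_cast this
    · have := guaranteedInfidelity_le hlam hlam1 hΨ hδ hδ1 hN hs hfloor
      -- `guaranteedInfidelity_le` already gives the bound without the summand `2/(λN)`.
      have h2 : 0 ≤ 2 / (lam * (N : ℝ)) := by positivity
      linarith
  refine ⟨main, ?_⟩
  have hinv : ∀ c d : ℝ, Filter.Tendsto (fun N : ℕ => c / (d * (N : ℝ))) Filter.atTop (nhds 0) := by
    intro c d
    have := tendsto_const_div_atTop_nhds_zero_nat (c / d)
    simpa only [div_div] using this
  have hsqrt : Filter.Tendsto (fun N : ℕ => √(s * Real.log δ⁻¹ / N)) Filter.atTop (nhds 0) := by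
    have := (tendsto_const_div_atTop_nhds_zero_nat (s * Real.log δ⁻¹)).sqrt
    rwa [Real.sqrt_zero] at this
  have hlow : Filter.Tendsto (fun N : ℕ => s - 1 / ((1 - lam) * (N : ℝ)))
      Filter.atTop (nhds s) := by
    simpa using (hinv 1 (1 - lam)).const_sub s
  have hup : Filter.Tendsto (fun N : ℕ => s + 1 / ((1 - lam) * lam) * √(s * Real.log δ⁻¹ / N)
      + Real.log δ⁻¹ / (2 * (1 - lam) ^ 2 * lam * N) + 2 / (lam * N))
      Filter.atTop (nhds s) := by
    simpa using (((hsqrt.const_mul (1 / ((1 - lam) * lam))).const_add s).add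
      (hinv (Real.log δ⁻¹) (2 * (1 - lam) ^ 2 * lam))).add (hinv 2 lam)
  refine tendsto_of_tendsto_of_tendsto_of_le_of_le' hlow hup ?_ ?_
  · filter_upwards [Filter.eventually_ge_atTop 1] with N hN using (main N hN).1.le
  · filter_upwards [Filter.eventually_ge_atTop 1] with N hN using (main N hN).2
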